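/- For a nonempty compact Hausdorff space $K$, let $C(K)$ be the space of real-valued continuous functions on $K$, let $\mathbf 1$ be the constant function with value one, and let $\overline{C(K)} = C(K)/\mathbb{R}\mathbf{1}$, where $\overline f$ denotes the class of $f$. Equip $\overline{C(K)}$ with the variation norm $\|\overline f\|_{\mathrm{var}} = \sup_{x\in K} f(x) - \inf_{x\in K} f(x)$. **Theorem.** Let $K_1$ and $K_2$ be nonempty compact Hausdorff spaces. A map $T\colon \overline{C(K_1)} \to \overline{C(K_2)}$ is an isometric isomorphism (a surjective linear isometry for the variation norms) if and only if there exist an $\varepsilon\in\{-1,1\}$ and a homeomorphism $\theta\colon K_2\to K_1$ such that $T\overline f = \overline{\varepsilon (f\circ\theta)}$ for all $f\in C(K_1)$. -/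

import Mathlib

/-- The quotient `C(K) / ℝ1` of the space of real-valued continuous functions on `K` by the
subspace of constant functions. It is given its own type, because it carries the variation norm
below and not the quotient norm of the supremum norm. -/
def QuotConst (K : Type*) [TopologicalSpace K] : Type _ :=
  C(K, ℝ) ⧸ Submodule.span ℝ {(1 : C(K, ℝ))}

namespace QuotConst

section Algebra

variable {K : Type*} [TopologicalSpace K]

noncomputable instance : AddCommGroup (QuotConst K) :=
  inferInstanceAs (AddCommGroup (C(K, ℝ) ⧸ Submodule.span ℝ {(1 : C(K, ℝ))}))

noncomputable instance : Module ℝ (QuotConst K) :=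
  inferInstanceAs (Module ℝ (C(K, ℝ) ⧸ Submodule.span ℝ {(1 : C(K, ℝ))}))

/-- The class of a continuous function modulo the constant functions. -/
noncomputable def mk : C(K, ℝ) →ₗ[ℝ] QuotConst K :=
  (Submodule.span ℝ {(1 : C(K, ℝ))}).mkQ

theorem mk_surjective : Function.Surjective (mk : C(K, ℝ) → QuotConst K) :=
  Submodule.mkQ_surjective _

theorem mk_eq_zero_iff (f : C(K, ℝ)) : mk f = 0 ↔ ∃ c : ℝ, ∀ x, f x = c := by
  have h : mk f = 0 ↔ f ∈ Submodule.span ℝ {(1 : C(K, ℝ))} :=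
    Submodule.Quotient.mk_eq_zero _
  rw [h, Submodule.mem_span_singleton]
  constructor
  · rintro ⟨c, rfl⟩
    exact ⟨c, fun x => by simp⟩
  · rintro ⟨c, hc⟩
    exact ⟨c, by ext x; simp [hc x]⟩

end Algebra

section Norm

variable {K : Type*} [TopologicalSpace K] [CompactSpace K]

/-- `sup f - inf f`. -/
noncomputable def variation (f : C(K, ℝ)) : ℝ := (⨆ x, f x) - ⨅ x, f x

theorem bddAbove (f : C(K, ℝ)) : BddAbove (Set.range f) :=
  (isCompact_range f.continuous).bddAbove

theorem bddBelow (f : C(K, ℝ)) : BddBelow (Set.range f) :=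
  (isCompact_range f.continuous).bddBelow

theorem sub_le_variation (f : C(K, ℝ)) (x y : K) : f x - f y ≤ variation f :=
  sub_le_sub (le_ciSup (bddAbove f) x) (ciInf_le (bddBelow f) y)

theorem variation_le [Nonempty K] (f : C(K, ℝ)) (r : ℝ) (h : ∀ x y, f x - f y ≤ r) :
    variation f ≤ r := by
  have h1 : ∀ y, (⨆ x, f x) ≤ r + f y := fun y =>
    ciSup_le fun x => by linarith [h x y]
  have h2 : (⨆ x, f x) - r ≤ ⨅ y, f y := le_ciInf fun y => by linarith [h1 y]
  unfold variation
  linarith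

theorem variation_of_isEmpty [IsEmpty K] (f : C(K, ℝ)) : variation f = 0 := by
  simp [variation]

theorem variation_nonneg (f : C(K, ℝ)) : 0 ≤ variation f := by
  rcases isEmpty_or_nonempty K with hK | ⟨⟨x⟩⟩
  · rw [variation_of_isEmpty]
  · simpa using sub_le_variation f x x

theorem variation_add_le (f g : C(K, ℝ)) : variation (f + g) ≤ variation f + variation g := by
  rcases isEmpty_or_nonempty K with hK | hK
  · simp [variation_of_isEmpty]
  · refine variation_le _ _ fun x y => ?_
    have h1 := sub_le_variation f x y
    have h2 := sub_le_variation g x y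
    simp only [ContinuousMap.add_apply]
    linarith

theorem variation_smul_le (c : ℝ) (f : C(K, ℝ)) : variation (c • f) ≤ |c| * variation f := by
  rcases isEmpty_or_nonempty K with hK | hK
  · simp [variation_of_isEmpty]
  · refine variation_le _ _ fun x y => ?_
    have h1 := sub_le_variation f x y
    have h2 := sub_le_variation f y x
    have h3 : |f x - f y| ≤ variation f := abs_le.mpr ⟨by linarith, h1⟩
    calc (c • f) x - (c • f) y = c * (f x - f y) := by simp; ring
      _ ≤ |c * (f x - f y)| := le_abs_self _
      _ = |c| * |f x - f y| := abs_mul _ _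
      _ ≤ |c| * variation f := mul_le_mul_of_nonneg_left h3 (abs_nonneg c)

theorem variation_smul (c : ℝ) (f : C(K, ℝ)) : variation (c • f) = |c| * variation f := by
  refine le_antisymm (variation_smul_le c f) ?_
  rcases eq_or_ne c 0 with rfl | hc
  · simpa using variation_nonneg _
  · have h := variation_smul_le c⁻¹ (c • f)
    rw [smul_smul, inv_mul_cancel₀ hc, one_smul, abs_inv] at h
    have hc' : 0 < |c| := abs_pos.mpr hc
    calc |c| * variation f ≤ |c| * (|c|⁻¹ * variation (c • f)) :=
          mul_le_mul_of_nonneg_left h hc'.le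
      _ = variation (c • f) := by rw [← mul_assoc, mul_inv_cancel₀ hc'.ne', one_mul]

theorem variation_eq_zero_iff (f : C(K, ℝ)) : variation f = 0 ↔ mk f = 0 := by
  rw [mk_eq_zero_iff]
  rcases isEmpty_or_nonempty K with hK | hK
  · simp [variation_of_isEmpty]
  · constructor
    · intro h
      obtain ⟨y⟩ := hK
      refine ⟨f y, fun x => ?_⟩
      have h1 := sub_le_variation f x y
      have h2 := sub_le_variation f y x
      linarith
    · rintro ⟨c, hc⟩
      exact le_antisymm (variation_le _ _ fun x y => by simp [hc]) (variation_nonneg f)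

theorem variation_congr (f g : C(K, ℝ)) (h : mk f = mk g) : variation f = variation g := by
  have key : ∀ f g : C(K, ℝ), mk f = mk g → variation f ≤ variation g := fun f g h => by
    have h0 : variation (f - g) = 0 := by
      rw [variation_eq_zero_iff, map_sub, h, sub_self]
    have h1 := variation_add_le (f - g) g
    rw [sub_add_cancel, h0, zero_add] at h1
    exact h1
  exact le_antisymm (key f g h) (key g f h.symm)

/-- The variation norm: the class of `f` has norm `sup f - inf f`. -/
noncomputable instance : Norm (QuotConst K) where
  norm := Quotient.lift variation fun f g h => variation_congr f g (Quotient.sound h)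

theorem norm_mk (f : C(K, ℝ)) : ‖mk f‖ = (⨆ x, f x) - ⨅ x, f x := rfl

theorem normCore : NormedSpace.Core ℝ (QuotConst K) where
  norm_nonneg x := by
    obtain ⟨f, rfl⟩ := mk_surjective x
    exact variation_nonneg f
  norm_smul c x := by
    obtain ⟨f, rfl⟩ := mk_surjective x
    rw [← map_smul]
    exact variation_smul c f
  norm_triangle x y := by
    obtain ⟨f, rfl⟩ := mk_surjective x
    obtain ⟨g, rfl⟩ := mk_surjective y
    rw [← map_add]
    exact variation_add_le f g
  norm_eq_zero_iff x := by
    obtain ⟨f, rfl⟩ := mk_surjective x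
    exact variation_eq_zero_iff f

noncomputable instance : NormedAddCommGroup (QuotConst K) :=
  NormedAddCommGroup.ofCore normCore

noncomputable instance : NormedSpace ℝ (QuotConst K) :=
  NormedSpace.ofCore normCore

end Norm

end QuotConst

/-! The functionals `diff a b`, sending the class of f to f a - f b, compute the norm as their
maximum. For x ≠ y, the face of the unit ball on which `diff x y` is one determines that functional
(`eq_diff_of_eq_one_on_face`), and a compactness argument puts the image of this face inside the
face of some pair. Hence a linear isometry S turns pairs into pairs: `diff a b ∘ S = diff x y`
(`exists_diff_comp_eq`).

The identity `diff x₀ y - diff x₀ z = diff z y` forces the image pairs of (x₀, y) and (x₀, z) to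
agree in a coordinate, so all pairs from x₀ share one fixed coordinate. Which coordinate it is gives
the sign ε; the other coordinate gives a point map σ, and θ is its inverse. -/

open Set

namespace QuotConst

/-! ### Two-point functionals and their faces -/

section Diff

variable {K : Type*} [TopologicalSpace K]

/-- The functional on `C(K) / ℝ1` sending the class of `f` to `f a - f b`. -/
noncomputable def diff (a b : K) : QuotConst K →ₗ[ℝ] ℝ :=
  (Submodule.span ℝ {(1 : C(K, ℝ))}).liftQ
    { toFun := fun f => f a - f b
      map_add' := fun f g => by simp only [ContinuousMap.add_apply]; ring
      map_smul' := fun c f => by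
        simp only [ContinuousMap.smul_apply, smul_eq_mul, RingHom.id_apply]; ring }
    (by
      rw [Submodule.span_singleton_le_iff_mem, LinearMap.mem_ker]
      simp)

theorem diff_mk (a b : K) (f : C(K, ℝ)) : diff a b (mk f) = f a - f b := rfl

theorem diff_self (a : K) (v : QuotConst K) : diff a a v = 0 := by
  obtain ⟨f, rfl⟩ := mk_surjective v
  simp [diff_mk]

theorem diff_swap (a b : K) (v : QuotConst K) : diff b a v = -diff a b v := by
  obtain ⟨f, rfl⟩ := mk_surjective v
  simp [diff_mk]

theorem diff_sub_left (a b c : K) (v : QuotConst K) : diff a b v - diff a c v = diff c b v := by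
  obtain ⟨f, rfl⟩ := mk_surjective v
  simp only [diff_mk]; ring

theorem diff_sub_right (a b c : K) (v : QuotConst K) : diff a c v - diff b c v = diff a b v := by
  obtain ⟨f, rfl⟩ := mk_surjective v
  simp only [diff_mk]; ring

theorem continuous_diff (v : QuotConst K) : Continuous fun p : K × K => diff p.1 p.2 v := by
  obtain ⟨f, rfl⟩ := mk_surjective v
  simp only [diff_mk]
  fun_prop

theorem ext_diff {v w : QuotConst K} (h : ∀ a b, diff a b v = diff a b w) : v = w := by
  rw [← sub_eq_zero]
  obtain ⟨f, hf⟩ := mk_surjective (v - w)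
  rw [← hf, mk_eq_zero_iff]
  rcases isEmpty_or_nonempty K with hK | ⟨⟨y⟩⟩
  · exact ⟨0, fun x => isEmptyElim x⟩
  · refine ⟨f y, fun x => ?_⟩
    have h1 : diff x y (mk f) = 0 := by rw [hf, map_sub, h, sub_self]
    rw [diff_mk] at h1
    linarith

variable [CompactSpace K]

theorem diff_le_norm (a b : K) (v : QuotConst K) : diff a b v ≤ ‖v‖ := by
  obtain ⟨f, rfl⟩ := mk_surjective v
  exact sub_le_variation f a b

theorem norm_le_of_diff_le [Nonempty K] {v : QuotConst K} {r : ℝ} (h : ∀ a b, diff a b v ≤ r) :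
    ‖v‖ ≤ r := by
  obtain ⟨f, rfl⟩ := mk_surjective v
  exact variation_le f r h

theorem exists_diff_eq_norm [Nonempty K] (v : QuotConst K) : ∃ a b, diff a b v = ‖v‖ := by
  obtain ⟨p, -, hp⟩ := isCompact_univ.exists_isMaxOn (univ_nonempty (α := K × K))
    (continuous_diff v).continuousOn
  exact ⟨p.1, p.2, le_antisymm (diff_le_norm _ _ _)
    (norm_le_of_diff_le fun a b => hp (mem_univ (a, b)))⟩

variable [T2Space K]

open scoped Classical in
/-- Continuous functions interpolate the indicator of a point on a finite set. -/
theorem exists_eq_indicator_on_finset (p : K) (s : Finset K) :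
    ∃ f : C(K, ℝ), ∀ q ∈ s, f q = if q = p then 1 else 0 := by
  obtain ⟨f, h0, h1, -⟩ := exists_continuous_zero_one_of_isClosed
    (s.erase p).finite_toSet.isClosed (isClosed_singleton (x := p))
    (by simp)
  refine ⟨f, fun q hq => ?_⟩
  split_ifs with h
  · subst h; exact h1 rfl
  · exact h0 (by simp [h, hq])

-- Evaluations at distinct points are linearly independent, so a relation between them can be
-- compared one coefficient at a time.
open scoped Classical in
theorem indicator_of_diff_sub_eq {a b c d e f : K}
    (h : ∀ v : QuotConst K, diff a b v - diff c d v = diff e f v) (p : K) :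
    ((if a = p then 1 else 0) - (if b = p then 1 else 0)) -
      ((if c = p then 1 else 0) - (if d = p then 1 else 0)) =
      ((if e = p then 1 else 0) - (if f = p then 1 else 0) : ℝ) := by
  obtain ⟨g, hg⟩ := exists_eq_indicator_on_finset p {a, b, c, d, e, f}
  have := h (mk g)
  simp only [diff_mk] at this
  rwa [hg a (by simp), hg b (by simp), hg c (by simp), hg d (by simp), hg e (by simp),
    hg f (by simp)] at this

/-- Otherwise nothing cancels between the positive part δ_a + δ_d and the negative part δ_b + δ_c,
so the positive mass is two, while δ_e - δ_f has at most one. -/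
theorem eq_or_eq_of_diff_sub_eq {a b c d e f : K} (hab : a ≠ b) (hcd : c ≠ d)
    (h : ∀ v : QuotConst K, diff a b v - diff c d v = diff e f v) : a = c ∨ b = d := by
  classical
  by_contra! hne
  have ha := indicator_of_diff_sub_eq h a
  have hb := indicator_of_diff_sub_eq h b
  have hc := indicator_of_diff_sub_eq h c
  have hd := indicator_of_diff_sub_eq h d
  grind

theorem mem_pair_of_diff_eq {a b c d : K} {r : ℝ} (hab : a ≠ b)
    (h : ∀ v : QuotConst K, diff c d v = r * diff a b v) (hr : r ≠ 0) : a = c ∨ a = d := by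
  classical
  by_contra! hne
  obtain ⟨g, hg⟩ := exists_eq_indicator_on_finset a {a, b, c, d}
  have := h (mk g)
  simp only [diff_mk] at this
  rw [hg a (by simp), hg b (by simp), hg c (by simp), hg d (by simp)] at this
  simp [hab.symm, hne.1.symm, hne.2.symm] at this
  exact hr this.symm

theorem eq_of_diff_eq_zero {a b : K} (h : ∀ v : QuotConst K, diff a b v = 0) : a = b := by
  classical
  by_contra hne
  obtain ⟨g, hg⟩ := exists_eq_indicator_on_finset a {a, b}
  have := h (mk g)
  rw [diff_mk, hg a (by simp), hg b (by simp)] at this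
  simp [Ne.symm hne] at this

/-- A functional equal to one on the face of the unit ball where `diff x y` equals one coincides
with `diff x y`. -/
theorem eq_diff_of_eq_one_on_face {x y : K} (hxy : x ≠ y) (φ : QuotConst K →ₗ[ℝ] ℝ)
    (hφ : ∀ v, diff x y v = 1 → ‖v‖ ≤ 1 → φ v = 1) (v : QuotConst K) : φ v = diff x y v := by
  have : Nonempty K := ⟨x⟩
  have face : ∀ f : C(K, ℝ), f x = 1 → f y = 0 → (∀ z, 0 ≤ f z ∧ f z ≤ 1) → φ (mk f) = 1 := by
    intro f h1 h0 hf
    refine hφ _ (by rw [diff_mk, h1, h0, sub_zero]) (norm_le_of_diff_le fun a b => ?_)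
    rw [diff_mk]
    linarith [(hf a).2, (hf b).1]
  obtain ⟨u, hu0, hu1, hu⟩ := exists_continuous_zero_one_of_isClosed
    (isClosed_singleton (x := y)) (isClosed_singleton (x := x)) (by simpa using hxy.symm)
  have hux : u x = 1 := hu1 rfl
  have huy : u y = 0 := hu0 rfl
  have small : ∀ g : C(K, ℝ), g x = 0 → g y = 0 → (∀ z, |g z| ≤ 1 / 2) → φ (mk g) = 0 := by
    intro g hx hy hg
    -- Clamping u between |g| and 1 - |g| keeps both w and w + g in the face, so φ takes equal
    -- values on them.
    let w : C(K, ℝ) := ⟨fun z => max |g z| (min (u z) (1 - |g z|)), by fun_prop⟩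
    have hw : ∀ z, |g z| ≤ w z ∧ w z ≤ 1 - |g z| := fun z =>
      ⟨le_max_left _ _, max_le (by linarith [hg z]) (min_le_right _ _)⟩
    have hwx : w x = 1 := by simp [w, hx, hux]
    have hwy : w y = 0 := by simp [w, hy, huy]
    have h1 := face w hwx hwy fun z =>
      ⟨(abs_nonneg _).trans (hw z).1, by linarith [(hw z).2, abs_nonneg (g z)]⟩
    have h2 := face (w + g) (by simp [hwx, hx]) (by simp [hwy, hy]) fun z => by
      have := neg_abs_le (g z)
      have := le_abs_self (g z)
      have := hw z
      simp only [ContinuousMap.add_apply]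
      constructor <;> linarith
    rw [map_add, map_add, h1] at h2
    linarith
  have vanishing : ∀ g : C(K, ℝ), g x = 0 → g y = 0 → φ (mk g) = 0 := by
    intro g hx hy
    have hc : 0 < 2 * (‖g‖ + 1) := by positivity
    have := small ((2 * (‖g‖ + 1))⁻¹ • g) (by simp [hx]) (by simp [hy]) fun z => by
      have hz := g.norm_coe_le_norm z
      rw [Real.norm_eq_abs] at hz
      rw [ContinuousMap.smul_apply, smul_eq_mul, abs_mul, abs_of_pos (inv_pos.mpr hc),
        inv_mul_le_iff₀ hc]
      linarith
    rw [map_smul, map_smul, smul_eq_mul] at this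
    exact (mul_eq_zero.mp this).resolve_left (inv_ne_zero hc.ne')
  obtain ⟨f, rfl⟩ := mk_surjective v
  have hone : mk (1 : C(K, ℝ)) = 0 := (mk_eq_zero_iff _).mpr ⟨1, fun _ => rfl⟩
  -- This correction of f vanishes at x and at y.
  have h := vanishing (f - (f x - f y) • u - f y • (1 : C(K, ℝ)))
    (by simp [hux]) (by simp [huy])
  simp only [map_sub, map_smul, hone, map_zero, smul_eq_mul, mul_zero,
    face u hux huy fun z => hu z] at h
  rw [diff_mk]
  linarith

end Diff

/-! ### From isometries to point maps -/

section Isometry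

variable {K₁ K₂ : Type*}
  [TopologicalSpace K₁] [CompactSpace K₁] [TopologicalSpace K₂] [CompactSpace K₂] [Nonempty K₂]

/-- An isometry maps a face of the unit ball given by a pair of points into another such face. -/
theorem exists_diff_eq_one_on_face (S : QuotConst K₁ →ₗᵢ[ℝ] QuotConst K₂) (x y : K₁) :
    ∃ a b, ∀ v, diff x y v = 1 → ‖v‖ ≤ 1 → diff a b (S v) = 1 := by
  let F := {v : QuotConst K₁ // diff x y v = 1 ∧ ‖v‖ ≤ 1}
  let P : F → Set (K₂ × K₂) := fun v => {p | diff p.1 p.2 (S v.1) = 1}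
  have hP : ∀ v, IsClosed (P v) := fun v => isClosed_eq (continuous_diff _) continuous_const
  have hfin : ∀ s : Finset F, (univ ∩ ⋂ v ∈ s, P v).Nonempty := by
    intro s
    -- The sum has norm at least the number of summands, and each summand contributes at most one at
    -- (a, b), so every contribution is exactly one.
    obtain ⟨a, b, hab⟩ := exists_diff_eq_norm (S (∑ v ∈ s, v.1))
    refine ⟨(a, b), mem_univ _, mem_iInter₂.mpr ?_⟩
    have hle : ∀ v ∈ s, diff a b (S v.1) ≤ 1 := fun v _ =>
      (diff_le_norm _ _ _).trans (by rw [S.norm_map]; exact v.2.2)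
    have hsum : ∑ v ∈ s, (1 : ℝ) ≤ ∑ v ∈ s, diff a b (S v.1) := by
      calc ∑ v ∈ s, (1 : ℝ) = diff x y (∑ v ∈ s, v.1) := by
            rw [map_sum]; exact Finset.sum_congr rfl fun v _ => v.2.1.symm
        _ ≤ ‖∑ v ∈ s, v.1‖ := diff_le_norm _ _ _
        _ = ∑ v ∈ s, diff a b (S v.1) := by rw [← S.norm_map, ← hab, map_sum, map_sum]
    exact (Finset.sum_eq_sum_iff_of_le hle).mp (le_antisymm (Finset.sum_le_sum hle) hsum)
  obtain ⟨p, -, hp⟩ := isCompact_univ.inter_iInter_nonempty P hP hfin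
  exact ⟨p.1, p.2, fun v h1 h2 => mem_iInter.mp hp ⟨v, h1, h2⟩⟩

variable [T2Space K₁]

theorem exists_diff_comp_eq (S : QuotConst K₁ →ₗᵢ[ℝ] QuotConst K₂) {x y : K₁} (hxy : x ≠ y) :
    ∃ a b, a ≠ b ∧ ∀ v, diff a b (S v) = diff x y v := by
  obtain ⟨a, b, hab⟩ := exists_diff_eq_one_on_face S x y
  have h := eq_diff_of_eq_one_on_face hxy (diff a b ∘ₗ S.toLinearMap) hab
  refine ⟨a, b, ?_, h⟩
  rintro rfl
  exact hxy (eq_of_diff_eq_zero fun v => (h v).symm.trans (diff_self _ _))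

variable [T2Space K₂]

/-- A surjective isometry is, up to sign, induced by a map of points. -/
theorem exists_point_map (S : QuotConst K₁ ≃ₗᵢ[ℝ] QuotConst K₂) :
    ∃ ε ∈ ({-1, 1} : Set ℝ), ∃ σ : K₁ → K₂, ∀ x y v,
      diff (σ x) (σ y) (S v) = ε * diff x y v := by
  classical
  rcases subsingleton_or_nontrivial K₁ with hK | hK
  · refine ⟨1, by simp, fun _ => Classical.arbitrary K₂, fun x y v => ?_⟩
    rw [Subsingleton.elim x y, diff_self, diff_self, mul_zero]
  obtain ⟨x₀, y₀, h₀⟩ := exists_pair_ne K₁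
  have hpair : ∀ y, x₀ ≠ y → ∃ a b, a ≠ b ∧ ∀ v, diff a b (S v) = diff x₀ y v := fun y hy =>
    exists_diff_comp_eq S.toLinearIsometry hy
  choose! α β hne h using hpair
  have share : ∀ y z, x₀ ≠ y → x₀ ≠ z → α y = α z ∨ β y = β z := by
    intro y z hy hz
    rcases eq_or_ne z y with rfl | hzy
    · exact Or.inl rfl
    obtain ⟨e, f, -, hef⟩ := exists_diff_comp_eq S.toLinearIsometry hzy
    refine eq_or_eq_of_diff_sub_eq (e := e) (f := f) (hne y hy) (hne z hz) fun w => ?_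
    obtain ⟨v, rfl⟩ := S.surjective w
    rw [h y hy, h z hz, diff_sub_left]
    exact (hef v).symm
  -- Points of a grid that pairwise share a row or a column all lie in one row or one column.
  have star : (∀ y, x₀ ≠ y → α y = α y₀) ∨ ∀ y, x₀ ≠ y → β y = β y₀ := by
    by_contra! hcon
    obtain ⟨⟨z, hz, hαz⟩, w, hw, hβw⟩ := hcon
    have hβz := (share z y₀ hz h₀).resolve_left hαz
    have hαw := (share w y₀ hw h₀).resolve_right hβw
    rcases share z w hz hw with h' | h'
    · exact hαz (h'.trans hαw)
    · exact hβw (h'.symm.trans hβz)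
  rcases star with hα | hβ
  · let σ : K₁ → K₂ := fun y => if x₀ = y then α y₀ else β y
    have hσ : ∀ y v, diff (α y₀) (σ y) (S v) = diff x₀ y v := by
      intro y v
      by_cases hy : x₀ = y
      · simp [σ, ← hy, diff_self]
      · simp only [σ, hy, if_false]
        rw [← hα y hy, h y hy]
    refine ⟨1, by simp, σ, fun x y v => ?_⟩
    rw [← diff_sub_left (α y₀), hσ, hσ, diff_sub_left, one_mul]
  -- Here x₀ corresponds to the second coordinate, so orientation is reversed and the sign is -1.
  · let σ : K₁ → K₂ := fun y => if x₀ = y then β y₀ else α y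
    have hσ : ∀ y v, diff (σ y) (β y₀) (S v) = diff x₀ y v := by
      intro y v
      by_cases hy : x₀ = y
      · simp [σ, ← hy, diff_self]
      · simp only [σ, hy, if_false]
        rw [← hβ y hy, h y hy]
    refine ⟨-1, by simp, σ, fun x y v => ?_⟩
    rw [← diff_sub_right _ _ (β y₀), hσ, hσ, diff_sub_left, diff_swap, neg_one_mul]

theorem bijective_of_diff_comp_eq [Nonempty K₁] (S : QuotConst K₁ ≃ₗᵢ[ℝ] QuotConst K₂)
    {ε : ℝ} (hε : ε ≠ 0) {σ : K₁ → K₂}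
    (hσ : ∀ x y v, diff (σ x) (σ y) (S v) = ε * diff x y v) : Function.Bijective σ := by
  constructor
  · intro x y hxy
    refine eq_of_diff_eq_zero fun v => ?_
    have := hσ x y v
    rw [hxy, diff_self] at this
    exact (mul_eq_zero.mp this.symm).resolve_left hε
  · intro p
    rcases subsingleton_or_nontrivial K₂ with hK | hK
    · exact ⟨Classical.arbitrary K₁, Subsingleton.elim _ _⟩
    obtain ⟨q, hq⟩ := exists_ne p
    -- Pulling (p, q) back through the inverse isometry gives a pair whose σ-images must include p.
    obtain ⟨x, y, -, hxy⟩ := exists_diff_comp_eq S.symm.toLinearIsometry hq.symm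
    have h : ∀ w, diff (σ x) (σ y) w = ε * diff p q w := fun w => by
      rw [← hxy w, ← hσ]
      simp
    rcases mem_pair_of_diff_eq hq.symm h hε with h | h
    · exact ⟨x, h.symm⟩
    · exact ⟨y, h.symm⟩

theorem exists_homeomorph [Nonempty K₁] (S : QuotConst K₁ ≃ₗᵢ[ℝ] QuotConst K₂) :
    ∃ ε ∈ ({-1, 1} : Set ℝ), ∃ θ : K₂ ≃ₜ K₁, ∀ f : C(K₁, ℝ),
      S (mk f) = mk (ε • f.comp (θ : C(K₂, K₁))) := by
  obtain ⟨ε, hε, σ, hσ⟩ := exists_point_map S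
  have hεε : ε * ε = 1 := by rcases hε with rfl | rfl <;> norm_num
  have hε0 : ε ≠ 0 := left_ne_zero_of_mul_eq_one hεε
  let e : K₁ ≃ K₂ := Equiv.ofBijective σ (bijective_of_diff_comp_eq S hε0 hσ)
  have he : ∀ p q v, diff p q (S v) = ε * diff (e.symm p) (e.symm q) v := fun p q v => by
    rw [← hσ]
    change _ = diff (e (e.symm p)) (e (e.symm q)) (S v)
    simp
  have hcont : Continuous e.symm := by
    -- Up to a constant, f ∘ σ⁻¹ is ε times a continuous representative of S (mk f); Urysohn
    -- functions then give continuity of σ⁻¹.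
    have hreal : ∀ f : C(K₁, ℝ), Continuous fun p => f (e.symm p) := by
      intro f
      obtain ⟨g, hg⟩ := mk_surjective (S (mk f))
      let q : K₂ := Classical.arbitrary K₂
      have : (fun p => f (e.symm p)) = fun p => f (e.symm q) + ε * (g p - g q) := by
        funext p
        have h := he p q (mk f)
        rw [← hg, diff_mk, diff_mk] at h
        rw [h, ← mul_assoc, hεε]
        ring
      rw [this]
      fun_prop
    rw [continuous_iff_continuousAt]
    intro p
    rw [ContinuousAt, tendsto_nhds]
    intro U hU hp
    obtain ⟨f, h0, h1, -⟩ := exists_continuous_zero_one_of_isClosed hU.isClosed_compl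
      (isClosed_singleton (x := e.symm p)) (by simpa using hp)
    have hfp : f (e.symm p) = 1 := h1 rfl
    have hev := (hreal f).continuousAt.eventually
      (isOpen_Ioi.mem_nhds (show (0 : ℝ) < f (e.symm p) by rw [hfp]; exact one_pos))
    filter_upwards [hev] with q hq
    by_contra hqU
    exact (ne_of_gt hq) (h0 hqU)
  refine ⟨ε, hε, hcont.homeoOfEquivCompactToT2, fun f => ext_diff fun p q => ?_⟩
  rw [he, diff_mk, diff_mk, mul_sub]
  rfl

end Isometry

/-! ### The converse: compositions are isometries -/

section Composition

variable {K₁ K₂ : Type*}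
  [TopologicalSpace K₁] [TopologicalSpace K₂]

theorem variation_comp_homeomorph (θ : K₂ ≃ₜ K₁) (f : C(K₁, ℝ)) :
    variation (f.comp (θ : C(K₂, K₁))) = variation f := by
  unfold variation
  congr 1
  · exact θ.surjective.iSup_comp f
  · exact θ.surjective.iInf_comp f

variable [CompactSpace K₁] [CompactSpace K₂]

theorem exists_linearIsometryEquiv {T : QuotConst K₁ → QuotConst K₂} {ε : ℝ}
    (hε : ε ∈ ({-1, 1} : Set ℝ)) (θ : K₂ ≃ₜ K₁)
    (hT : ∀ f : C(K₁, ℝ), T (mk f) = mk (ε • f.comp (θ : C(K₂, K₁)))) :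
    ∃ S : QuotConst K₁ ≃ₗᵢ[ℝ] QuotConst K₂, ⇑S = T := by
  have hεε : ε * ε = 1 := by rcases hε with rfl | rfl <;> norm_num
  have habs : |ε| = 1 := by rcases hε with rfl | rfl <;> norm_num
  let L : QuotConst K₁ →ₗᵢ[ℝ] QuotConst K₂ :=
    { toFun := T
      map_add' := fun v w => by
        obtain ⟨f, rfl⟩ := mk_surjective v
        obtain ⟨g, rfl⟩ := mk_surjective w
        rw [← map_add, hT, hT, hT, ← map_add, ← smul_add]
        rfl
      map_smul' := fun c v => by
        obtain ⟨f, rfl⟩ := mk_surjective v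
        rw [← map_smul, hT, hT, RingHom.id_apply, ← map_smul, smul_comm c]
        rfl
      norm_map' := fun v => by
        obtain ⟨f, rfl⟩ := mk_surjective v
        change ‖T (mk f)‖ = _
        rw [hT]
        change variation _ = variation f
        rw [variation_smul, habs, one_mul, variation_comp_homeomorph] }
  have hL : Function.Surjective L := fun w => by
    obtain ⟨g, rfl⟩ := mk_surjective w
    -- Since ε² = 1, the same sign with θ⁻¹ gives a preimage.
    refine ⟨mk (ε • g.comp (θ.symm : C(K₁, K₂))), (hT _).trans (congrArg mk ?_)⟩
    ext p
    simp [← mul_assoc, hεε]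
  exact ⟨LinearIsometryEquiv.ofSurjective L hL, rfl⟩

end Composition

end QuotConst

theorem mainTheorem3 {K₁ K₂ : Type*}
    [TopologicalSpace K₁] [CompactSpace K₁] [T2Space K₁] [Nonempty K₁]
    [TopologicalSpace K₂] [CompactSpace K₂] [T2Space K₂] [Nonempty K₂]
    (T : QuotConst K₁ → QuotConst K₂) :
    (∃ S : QuotConst K₁ ≃ₗᵢ[ℝ] QuotConst K₂, ⇑S = T) ↔
      ∃ ε ∈ ({-1, 1} : Set ℝ), ∃ θ : K₂ ≃ₜ K₁, ∀ f : C(K₁, ℝ),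
        T (QuotConst.mk f) = QuotConst.mk (ε • f.comp (θ : C(K₂, K₁))) := by
  constructor
  · rintro ⟨S, rfl⟩
    exact QuotConst.exists_homeomorph S
  · rintro ⟨ε, hε, θ, hT⟩
    exact QuotConst.exists_linearIsometryEquiv hε θ hT
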